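/- All graphs are finite and simple. \textbf{Linear NLC-width.} Let $k\in\mathbb N$ and let $V$ be a finite set. A linear NLC-expression of width $k$ over $V$ is a finite word $\alpha$ whose letters are quadruples $a=(v_a,c_a,e_a,r_a)$ with $v_a\in V$, $c_a\in[k]$, $e_a\subseteq[k]$, $r_a\colon[k]\to[k]$, such that no two letters have the same $v$-value. It defines a graph $\Xi(\alpha)$ with vertices colored by $[k]$: the empty word gives the empty graph; if $\alpha=a$ is a single letter, $\Xi(\alpha)$ is the single vertex $v_a$, colored $c_a$; if $\alpha=\alpha'a$ with $\alpha'$ nonempty, $\Xi(\alpha)$ is obtained from $\Xi(\alpha')$ by adding the vertex $v_a$ with color $c_a$, joining $v_a$ to all vertices of $\Xi(\alpha')$ whose color is in $e_a$, and finally changing every color $i$ to $r_a(i)$. The linear NLC-width of a graph $G$ is the least $k$ such that $G=\Xi(\alpha)$ (ignoring colors) for some linear NLC-expression $\alpha$ of width $k$ over $V(G)$. A class of graphs has bounded linear NLC-width if there is a $k$ such that every graph in the class has linear NLC-width at most $k$. \textbf{Half-graphs.} The half-graph $H_n$ is the bipartite graph with parts $\{a_1,\dots,a_n\}$ and $\{b_1,\dots,b_n\}$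 in which $a_i$ and $b_j$ are adjacent if and only if $i\le j$. It is semi-induced in a graph $G$ if there are $2n$ pairwise distinct vertices $x_1,\dots,x_n,y_1,\dots,y_n$ of $G$ such that, for all $i,j$, $x_i$ and $y_j$ are adjacent in $G$ if and only if $i\le j$ (adjacencies among the $x_i$, and among the $y_j$, are arbitrary). A class $\mathscr C$ excludes some semi-induced half-graph if there is an $n$ such that $H_n$ is semi-induced in no graph of $\mathscr C$. \textbf{Pathwidth.} An interval graph is the intersection graph of a finite family of intervals of the real line. The pathwidth of $G$ is one less than the minimum clique number of an interval supergraph of $G$; a class has bounded pathwidth if the pathwidths of its graphs are bounded by a constant. \textbf{Transductions.} A graph is viewed as a structure over one binary relation symbol $E$. A class $\mathscr C$ of graphs is a (first-order) transduction of a class $\mathscr D$ of graphs if there are a finite set of unary relation symbols $U_1,\dots,U_p$ and first-order formulas $\nu(x)$ and $\varphi_E(x,y)$ over the signature $\{E,U_1,\dots,U_p\}$ such that for every $B\in\mathscr C$ there are a graph $A\in\mathscr D$ and an expansion $A^+$ of $A$ by interpretations of $U_1,\dots,U_p$ such that $B$ is isomorphic to the structure with domain $\nu(A^+)$ and edge relation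 $\varphi_E(A^+)\cap\nu(A^+)^2$. \textbf{Theorem.} Let $\mathscr C$ be a class of graphs with bounded linear NLC-width. If $\mathscr C$ excludes some semi-induced half-graph, then $\mathscr C$ is a transduction of a class of graphs with bounded pathwidth. -/

import Mathlib

universe u

namespace LinearNLC

open FirstOrder

/-! ### Classes of finite graphs -/

/-- A finite simple graph, bundled with its vertex set. -/
structure FinGraph where
  V : Type*
  finite : Finite V
  graph : SimpleGraph V

/-- A class of finite graphs. -/
abbrev GraphClass := Set FinGraph

/-! ### Linear NLC-width -/

/-- A letter `(v, c, e, r)` of the alphabet `Ω_k(V)`. -/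
structure Letter (k : ℕ) (V : Type*) where
  v : V
  c : Fin k
  e : Set (Fin k)
  r : Fin k → Fin k

/-- A graph whose vertices are elements of `V`, coloured by `Fin k`. An element `w : V` is a vertex
of the graph if and only if `color w` is not `none`. -/
structure ColoredGraph (k : ℕ) (V : Type*) where
  color : V → Option (Fin k)
  graph : SimpleGraph V

open Classical in
/-- The one-vertex graph with vertex `v_a`, coloured `c_a`. -/
noncomputable def ColoredGraph.single {k : ℕ} {V : Type*} (a : Letter k V) : ColoredGraph k V where
  color w := if w = a.v then some a.c else none
  graph := ⊥

open Classical in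
/-- Add the vertex `v_a` with colour `c_a`, join it to all present vertices with a colour in `e_a`,
and finally recolour every vertex (the new one included) by `r_a`. -/
noncomputable def ColoredGraph.extend {k : ℕ} {V : Type*} (X : ColoredGraph k V) (a : Letter k V) :
    ColoredGraph k V where
  color w := (if w = a.v then some a.c else X.color w).map a.r
  graph := X.graph ⊔ SimpleGraph.fromRel fun x y => x = a.v ∧ ∃ i ∈ a.e, X.color y = some i

/-- The coloured graph `Ξ(α)` of a word `α`; letters are read from left to right. The empty word
gives the graph without vertices. -/
noncomputable def xi {k : ℕ} {V : Type*} : List (Letter k V) → ColoredGraph k V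
  | [] => ⟨fun _ => none, ⊥⟩
  | a :: l => l.foldl ColoredGraph.extend (ColoredGraph.single a)

/-- A word is admissible if no two of its letters have the same `v`-value. -/
def Admissible {k : ℕ} {V : Type*} (α : List (Letter k V)) : Prop :=
  (α.map Letter.v).Nodup

/-- `G` is identical to `Ξ(α)` for some linear NLC-expression `α` of width `k` over `V(G)`:
every element of `V` is a vertex of `Ξ(α)`, and the edges agree. -/
def HasLinearNLCExpression {V : Type*} (G : SimpleGraph V) (k : ℕ) : Prop :=
  ∃ α : List (Letter k V), Admissible α ∧ (∀ w, (xi α).color w ≠ none) ∧ (xi α).graph = G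

/-- The linear NLC-width of a graph: the minimum `k` such that the graph has a linear
NLC-expression of width `k`. -/
noncomputable def linearNLCWidth {V : Type*} (G : SimpleGraph V) : ℕ∞ :=
  ⨅ (k : ℕ) (_ : HasLinearNLCExpression G k), (k : ℕ∞)

def BoundedLinearNLCWidth (C : GraphClass) : Prop :=
  ∃ k : ℕ, ∀ G ∈ C, linearNLCWidth G.graph ≤ k

/-! ### Semi-induced half-graphs -/

/-- The half-graph of order `n`: vertices `a_i = inl i`, `b_j = inr j`, and edges `a_i b_j` for
`i ≤ j`. -/
def halfGraph (n : ℕ) : SimpleGraph (Fin n ⊕ Fin n) where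
  Adj
    | .inl i, .inr j => i ≤ j
    | .inr j, .inl i => i ≤ j
    | _, _ => False
  symm := ⟨by rintro (i | i) (j | j) h <;> exact h⟩
  loopless := ⟨by rintro (i | i) h <;> exact h⟩

/-- The bipartite graph `H`, with parts `A` and `B`, is a semi-induced subgraph of `G`: there are
disjoint copies of `A` and `B` in `V(G)` between which `G` has exactly the edges of `H`
(the edges of `G` inside the two copies are arbitrary). -/
def IsSemiInduced {A B V : Type*} (H : SimpleGraph (A ⊕ B)) (G : SimpleGraph V) : Prop :=
  ∃ f : A ⊕ B ↪ V, ∀ a b, G.Adj (f (.inl a)) (f (.inr b)) ↔ H.Adj (.inl a) (.inr b)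

def ExcludesSemiInducedHalfGraph (C : GraphClass) : Prop :=
  ∃ n : ℕ, ∀ G ∈ C, ¬ IsSemiInduced (halfGraph n) G.graph

/-! ### Pathwidth -/

/-- The intersection graph of a family of sets. -/
def intersectionGraph {V X : Type*} (S : V → Set X) : SimpleGraph V where
  Adj u v := u ≠ v ∧ (S u ∩ S v).Nonempty
  symm := ⟨fun u v h => ⟨h.1.symm, by rw [Set.inter_comm]; exact h.2⟩⟩
  loopless := ⟨fun _ h => h.1 rfl⟩

/-- An interval graph is the intersection graph of a family of (nonempty) real intervals. -/
def IsIntervalGraph {V : Type*} (H : SimpleGraph V) : Prop :=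
  ∃ l r : V → ℝ, (∀ v, l v ≤ r v) ∧ H = intersectionGraph fun v => Set.Icc (l v) (r v)

/-- The pathwidth of a finite graph: one less than the minimum clique number of an interval
supergraph. -/
noncomputable def pathwidth {V : Type*} (G : SimpleGraph V) : ℤ :=
  sInf {w : ℤ | ∃ H : SimpleGraph V, G ≤ H ∧ IsIntervalGraph H ∧ w = (H.cliqueNum : ℤ) - 1}

def BoundedPathwidth (D : GraphClass) : Prop :=
  ∃ k : ℕ, ∀ G ∈ D, pathwidth G.graph ≤ k

/-! ### First-order transductions -/

/-- Unary relation symbols indexed by `κ`. -/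
inductive MonadicRel (κ : Type) : ℕ → Type
  | mark : κ → MonadicRel κ 1

/-- The signature consisting of unary relation symbols indexed by `κ`. -/
def monadic (κ : Type) : Language := ⟨fun _ => Empty, MonadicRel κ⟩

/-- The structure given by a family of subsets of the domain. -/
@[reducible]
def monadicStructure {κ : Type} {M : Type*} (P : κ → Set M) : (monadic κ).Structure M where
  funMap f := nomatch f
  RelMap | .mark i => fun x => x 0 ∈ P i

/-- The monadic lift of a graph `G` by the unary predicates `P`. -/
@[reducible]
def monadicLift {κ : Type} {M : Type*} (G : SimpleGraph M) (P : κ → Set M) :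
    (Language.graph.sum (monadic κ)).Structure M :=
  @Language.sumStructure _ _ M G.structure (monadicStructure P)

/-- An interpretation of `L'`-structures in `L`-structures: a formula `ν(x)` and a formula
`φ_R(x₁, …, xₙ)` for each relation symbol `R` of `L'`. -/
structure Interpretation (L L' : Language) where
  dom : L.Formula (Fin 1)
  rel : ∀ {n : ℕ}, L'.Relations n → L.Formula (Fin n)

/-- The domain `ν(A)` of the structure `I(A)`. -/
def Interpretation.Domain {L L' : Language} (I : Interpretation L L') (M : Type*)
    [L.Structure M] : Type _ :=
  {x : M // I.dom.Realize fun _ => x}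

/-- The structure `I(A)`. -/
instance Interpretation.structure {L L' : Language} [L'.IsRelational] (I : Interpretation L L')
    (M : Type*) [L.Structure M] : L'.Structure (I.Domain M) where
  funMap f := isEmptyElim f
  RelMap R x := (I.rel R).Realize fun i => (x i).1

/-- The graph `B` is (isomorphic to) the structure `I(A⁺)`, where `A⁺` is the monadic lift of the
graph `A` by the unary predicates `P`. -/
def IsInterpretedIn {κ : Type} {N M : Type*} (B : SimpleGraph N)
    (I : Interpretation (Language.graph.sum (monadic κ)) Language.graph)
    (A : SimpleGraph M) (P : κ → Set M) : Prop :=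
  letI := B.structure
  letI := monadicLift A P
  Nonempty (N ≃[Language.graph] I.Domain M)

/-- The class `C` is a (first-order) transduction of the class `D`: for some fixed finite set of
unary relation symbols and some fixed interpretation `I`, every graph in `C` is `I(A⁺)` for some
monadic lift `A⁺` of some graph `A` in `D`. -/
def IsTransductionOf (C D : GraphClass) : Prop :=
  ∃ (p : ℕ) (I : Interpretation (Language.graph.sum (monadic (Fin p))) Language.graph),
    ∀ B ∈ C, ∃ A ∈ D, ∃ P : Fin p → Set A.V, IsInterpretedIn B.graph I A.graph P

end LinearNLC

/-! A linear NLC-expression is a word of maps on a finite colour set `K`: a later vertex `v` is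
adjacent to an earlier `u` according to whether the colour of `u`, transported by the maps in
between, lies in `e v`. The point is to read off this transported colour from bounded information.

For each `t` from `0` to `|K|`, cut the word greedily into blocks, closing a block as soon as its
product has rank at most `t`. Level `0` has one block and level `|K|` has singletons, so any two
vertices share a block at some level `t` and are separated at level `t + 1`. If their level-`(t +
1)` blocks are consecutive, the transport factors through the boundary, and each vertex records its
own half (`mem_iff_of_consecutive`). Otherwise a completed block of rank at most `t + 1` lies in
between, while the common level-`t` block, still incomplete at its last position, has rank at least
`t + 1`. Hence nothing more is merged from the completed block to that last position: the colour of
`u` there determines its colour at `v` (`mem_iff_of_far`).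

These labels presuppose knowing which vertex comes first. This matters only if the two orders
predict different adjacencies; then long alternating chains of the two labels would form
half-graphs, so chain lengths are bounded and comparing them reveals the order (`lt_iff_chains`).

The result is a `LocalDescription`: adjacency depends on finite labels and on which blocks coincide
or are consecutive. The graph with one hub per block, joined to its members and to the neighbouring
hubs of its level, has bounded pathwidth (`pathwidth_hubGraph_le`). With labels, levels and residues
modulo 3 as unary predicates, it interprets the original graph (`exists_interpretation`). -/

namespace LinearNLC

/-! ### Products of factors of a word of maps -/

section Transfer

variable {K : Type*} (r : ℕ → K → K)

/-- The composition `r (j - 1) ∘ ⋯ ∘ r i` (the identity if `j ≤ i`). -/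
def transfer (i : ℕ) : ℕ → K → K
  | 0 => id
  | j + 1 => if i ≤ j then r j ∘ transfer i j else id

theorem transfer_of_le {i j : ℕ} (h : j ≤ i) : transfer r i j = id := by
  cases j with
  | zero => rfl
  | succ j => simp [transfer, Nat.not_le.2 h]

theorem transfer_succ {i j : ℕ} (h : i ≤ j) :
    transfer r i (j + 1) = r j ∘ transfer r i j := by
  simp [transfer, h]

theorem transfer_comp {i j l : ℕ} (hij : i ≤ j) (hjl : j ≤ l) :
    transfer r i l = transfer r j l ∘ transfer r i j := by
  induction l, hjl using Nat.le_induction with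
  | base => simp [transfer_of_le r le_rfl]
  | succ l hl ih => rw [transfer_succ r (hij.trans hl), transfer_succ r hl, ih]; rfl

theorem transfer_comp_apply {i j l : ℕ} (hij : i ≤ j) (hjl : j ≤ l) (x : K) :
    transfer r i l x = transfer r j l (transfer r i j x) := by
  rw [transfer_comp r hij hjl]; rfl

theorem transfer_congr {r r' : ℕ → K → K} {i j : ℕ} (h : ∀ m < j, r m = r' m) :
    transfer r i j = transfer r' i j := by
  induction j with
  | zero => rfl
  | succ j ih => simp only [transfer]; rw [ih fun m hm => h m (by omega), h j (by omega)]

/-- The rank of a map is the size of its range. -/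
noncomputable def mapRank (f : K → K) : ℕ := (Set.range f).ncard

variable [Finite K]

theorem mapRank_comp_le_right (g f : K → K) : mapRank (g ∘ f) ≤ mapRank f := by
  rw [mapRank, Set.range_comp]; exact Set.ncard_image_le

theorem mapRank_comp_le_left (g f : K → K) : mapRank (g ∘ f) ≤ mapRank g :=
  Set.ncard_le_ncard (Set.range_comp_subset_range f g)

theorem mapRank_le_card (f : K → K) : mapRank f ≤ Nat.card K := Set.ncard_le_card _

theorem mapRank_pos [Nonempty K] (f : K → K) : 0 < mapRank f :=
  (Set.ncard_pos).2 (Set.range_nonempty f)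

/-- If composing with `g` loses no rank, then `g` merges no two values of `f`. This is how rank
bounds let an earlier colour be recovered from a later one. -/
theorem injOn_range_of_mapRank_le {g f : K → K} (h : mapRank f ≤ mapRank (g ∘ f)) :
    Set.InjOn g (Set.range f) := by
  apply Set.injOn_of_ncard_image_eq
  · rw [← Set.range_comp]
    exact le_antisymm (mapRank_comp_le_right g f) h
  · exact Set.toFinite _

end Transfer

/-! ### Greedy decomposition into blocks -/

section Blocks

variable {K : Type*} (r : ℕ → K → K) (t : ℕ)

open Classical in
/-- The first position of the block of level `t` that contains position `i`. A block is closed as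
soon as its product has rank at most `t`. -/
noncomputable def blockStart : ℕ → ℕ
  | 0 => 0
  | i + 1 => if mapRank (transfer r (blockStart i) (i + 1)) ≤ t then i + 1 else blockStart i

open Classical in
/-- The index of the block of level `t` that contains position `i`. -/
noncomputable def blockIndex : ℕ → ℕ
  | 0 => 0
  | i + 1 => if mapRank (transfer r (blockStart r t i) (i + 1)) ≤ t then blockIndex i + 1
      else blockIndex i

theorem blockStart_le (i : ℕ) : blockStart r t i ≤ i := by
  induction i with
  | zero => rfl
  | succ i ih => simp only [blockStart]; split_ifs <;> omega

theorem blockIndex_succ_le (i : ℕ) : blockIndex r t (i + 1) ≤ blockIndex r t i + 1 := by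
  simp only [blockIndex]; split_ifs <;> omega

theorem blockIndex_mono : Monotone (blockIndex r t) := by
  apply monotone_nat_of_le_succ
  intro i
  simp only [blockIndex]; split_ifs <;> omega

theorem exists_blockIndex_eq {i β : ℕ} (h : β ≤ blockIndex r t i) :
    ∃ j ≤ i, blockIndex r t j = β := by
  induction i with
  | zero => exact ⟨0, le_rfl, by simp only [blockIndex] at h ⊢; omega⟩
  | succ i ih =>
    rcases Nat.lt_or_ge (blockIndex r t i) β with h' | h'
    · exact ⟨i + 1, le_rfl, by have := blockIndex_succ_le r t i; omega⟩
    · obtain ⟨j, hj, e⟩ := ih h'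
      exact ⟨j, by omega, e⟩

theorem blockStart_eq_iff_of_le {i j : ℕ} (h : i ≤ j) :
    blockStart r t i = blockStart r t j ↔ blockIndex r t i = blockIndex r t j := by
  induction j, h using Nat.le_induction with
  | base => simp
  | succ j hj ih =>
    have h1 := blockStart_le r t i
    have h2 := blockIndex_mono r t hj
    simp only [blockStart, blockIndex]
    split_ifs with hc
    -- A block opening at `j + 1` starts after `i` and has a new index, so both equalities fail.
    · omega
    · exact ih

theorem blockStart_eq_iff {i j : ℕ} :
    blockStart r t i = blockStart r t j ↔ blockIndex r t i = blockIndex r t j := by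
  rcases le_total i j with h | h
  · exact blockStart_eq_iff_of_le r t h
  · rw [eq_comm, blockStart_eq_iff_of_le r t h, eq_comm]

theorem blockStart_succ_cases (i : ℕ) :
    (blockStart r t (i + 1) = i + 1 ∧ blockIndex r t (i + 1) = blockIndex r t i + 1 ∧
      mapRank (transfer r (blockStart r t i) (i + 1)) ≤ t) ∨
    (blockStart r t (i + 1) = blockStart r t i ∧ blockIndex r t (i + 1) = blockIndex r t i ∧
      t < mapRank (transfer r (blockStart r t i) (i + 1))) := by
  simp only [blockStart, blockIndex]
  split_ifs with h
  · exact .inl ⟨rfl, rfl, h⟩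
  · exact .inr ⟨rfl, rfl, not_le.1 h⟩

theorem blockStart_blockStart (i : ℕ) :
    blockStart r t (blockStart r t i) = blockStart r t i := by
  induction i with
  | zero => rfl
  | succ i ih =>
    rcases blockStart_succ_cases r t i with h | h
    · rw [h.1, h.1]
    · rw [h.1, ih]

theorem blockIndex_blockStart (i : ℕ) :
    blockIndex r t (blockStart r t i) = blockIndex r t i :=
  (blockStart_eq_iff r t).1 (blockStart_blockStart r t i)

/-- A completed block of level `t` has rank at most `t`. -/
theorem mapRank_completed_block {q : ℕ} (hq : blockStart r t (q + 1) = q + 1) :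
    mapRank (transfer r (blockStart r t q) (q + 1)) ≤ t ∧
      blockIndex r t (q + 1) = blockIndex r t q + 1 := by
  rcases blockStart_succ_cases r t q with h | h
  · exact ⟨h.2.2, h.2.1⟩
  · have := blockStart_le r t q; omega

/-- An incomplete block of level `t` has rank greater than `t`. -/
theorem lt_mapRank_incomplete_block (ht : t < Nat.card K) (i : ℕ) :
    t < mapRank (transfer r (blockStart r t i) i) := by
  have hid : t < mapRank (id : K → K) := by simpa [mapRank, Set.ncard_univ] using ht
  cases i with
  | zero => simpa [transfer_of_le] using hid
  | succ i =>
    rcases blockStart_succ_cases r t i with h | h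
    · rw [h.1, transfer_of_le r le_rfl]; exact hid
    · rw [h.1]; exact h.2.2

/-- Over a nonempty colour set no product has rank `0`, so the first block is never closed. -/
theorem blockIndex_zero [Finite K] [Nonempty K] (i : ℕ) : blockIndex r 0 i = 0 := by
  induction i with
  | zero => rfl
  | succ i ih =>
    rcases blockStart_succ_cases r 0 i with h | h
    · have := mapRank_pos (transfer r (blockStart r 0 i) (i + 1)); omega
    · rw [h.2.1, ih]

/-- Every map has rank at most `|K|`, so each block closes after a single position. -/
theorem blockIndex_card [Finite K] (i : ℕ) : blockIndex r (Nat.card K) i = i := by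
  induction i with
  | zero => rfl
  | succ i ih =>
    rcases blockStart_succ_cases r (Nat.card K) i with h | h
    · rw [h.2.1, ih]
    · have := mapRank_le_card (transfer r (blockStart r (Nat.card K) i) (i + 1)); omega

open Classical in
/-- The last position, among those up to `n`, of the block of level `t` that contains `i`. -/
noncomputable def blockEnd (n i : ℕ) : ℕ :=
  Nat.findGreatest (fun e => blockIndex r t e = blockIndex r t i) n

theorem le_blockEnd {n i j : ℕ} (hj : j ≤ n) (h : blockIndex r t j = blockIndex r t i) :
    j ≤ blockEnd r t n i := by
  classical
  exact Nat.le_findGreatest hj h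

theorem blockIndex_blockEnd {n i : ℕ} (hi : i ≤ n) :
    blockIndex r t (blockEnd r t n i) = blockIndex r t i := by
  classical
  exact Nat.findGreatest_spec (P := fun e => blockIndex r t e = blockIndex r t i) hi rfl

theorem blockEnd_congr {n i j : ℕ} (h : blockIndex r t i = blockIndex r t j) :
    blockEnd r t n i = blockEnd r t n j := by
  simp only [blockEnd, h]

/-- The existence of `j ≤ n` in the next block ensures that the block of `i` ends by itself and is
not cut off by the bound `n`. -/
theorem blockEnd_succ {n i j : ℕ} (hi : i ≤ n) (hj : j ≤ n)
    (h : blockIndex r t j = blockIndex r t i + 1) : blockEnd r t n i + 1 = blockStart r t j := by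
  have h1 := blockIndex_blockEnd r t hi
  set E := blockEnd r t n i with hE
  have hEj : E < j := by
    by_contra hc
    have := blockIndex_mono r t (not_lt.1 hc)
    omega
  have h2 : blockIndex r t (E + 1) = blockIndex r t i + 1 := by
    have h3 := blockIndex_succ_le r t E
    have h4 := blockIndex_mono r t (Nat.le_add_right E 1)
    rcases Nat.lt_or_ge (blockIndex r t i) (blockIndex r t (E + 1)) with h5 | h5
    · omega
    · have : E + 1 ≤ blockEnd r t n i := le_blockEnd r t (by omega) (by omega)
      omega
  rcases blockStart_succ_cases r t E with h5 | h5
  · rw [← h5.1, blockStart_eq_iff]; omega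
  · omega

/-- Positions `i < j` in a common block of level `t`, but in distinct blocks of level `t + 1` which
are not consecutive: the colour received at `j` from `i` is determined by the colour received at the
end of the common block. -/
theorem mem_iff_of_far [Finite K] {n i j : ℕ} (ht : t < Nat.card K) (hj : j ≤ n)
    (hs : blockIndex r t i = blockIndex r t j)
    (hfar : blockIndex r (t + 1) i + 2 ≤ blockIndex r (t + 1) j) (c : K) (e : Set K) :
    transfer r i j c ∈ e ↔
      transfer r i (blockEnd r t n i) c ∈
        {y | ∃ z ∈ Set.range (transfer r (blockStart r (t + 1) (blockStart r (t + 1) j - 1))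
              (blockStart r (t + 1) j)),
          transfer r (blockStart r (t + 1) j) (blockEnd r t n j) z = y ∧
          transfer r (blockStart r (t + 1) j) j z ∈ e} := by
  set q := blockStart r (t + 1) j with hq
  set p := blockStart r (t + 1) (q - 1) with hp
  have hqj : q ≤ j := blockStart_le r (t + 1) j
  have hqi : blockIndex r (t + 1) q = blockIndex r (t + 1) j := blockIndex_blockStart r (t + 1) j
  have hq0 : 0 < q := by
    rcases Nat.eq_zero_or_pos q with h | h
    · rw [h] at hqi; simp only [blockIndex] at hqi; omega
    · exact h
  obtain ⟨q', hq'⟩ : ∃ q', q = q' + 1 := ⟨q - 1, by omega⟩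
  have hcomp := mapRank_completed_block r (t + 1) (q := q')
    (by rw [← hq', hq, blockStart_blockStart])
  rw [← hq', show q' = q - 1 by omega, ← hp] at hcomp
  have hpi : blockIndex r (t + 1) p = blockIndex r (t + 1) (q - 1) := blockIndex_blockStart _ _ _
  have hip : i ≤ p := by
    by_contra hc
    have := blockIndex_mono r (t + 1) (not_le.1 hc).le
    omega
  have hpq : p ≤ q := by have := blockStart_le r (t + 1) (q - 1); omega
  have hEE : blockEnd r t n i = blockEnd r t n j := blockEnd_congr r t hs
  set E := blockEnd r t n j with hE
  have hjE : j ≤ E := le_blockEnd r t hj rfl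
  have hstart : blockStart r t E = blockStart r t i :=
    (blockStart_eq_iff r t).2 ((blockIndex_blockEnd r t hj).trans hs.symm)
  -- The common level-`t` block has not been closed at `E`, and its product up to `E` factors
  -- through `transfer r p E` because it starts no later than `i ≤ p`.
  have hrank : t < mapRank (transfer r p E) := by
    have h1 := lt_mapRank_incomplete_block r t ht E
    rw [hstart, transfer_comp r ((blockStart_le r t i).trans hip) (hpq.trans (hqj.trans hjE))] at h1
    exact h1.trans_le (mapRank_comp_le_left _ _)
  -- The completed block from `p` to `q` has rank at most `t + 1`, already attained by the longer
  -- product up to `E`.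
  have hinj : Set.InjOn (transfer r q E) (Set.range (transfer r p q)) := by
    apply injOn_range_of_mapRank_le
    rw [← transfer_comp r hpq (hqj.trans hjE)]
    omega
  have hmem : transfer r i q c ∈ Set.range (transfer r p q) :=
    ⟨transfer r i p c, (transfer_comp_apply r hip hpq c).symm⟩
  rw [transfer_comp_apply r (hip.trans hpq) hqj, hEE,
    transfer_comp_apply r (hip.trans hpq) (hqj.trans hjE)]
  constructor
  · intro h; exact ⟨_, hmem, rfl, h⟩
  · rintro ⟨z, hz, h1, h2⟩
    rwa [← hinj hz hmem h1]

/-- Positions in consecutive blocks of level `t`. -/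
theorem mem_iff_of_consecutive {n i j : ℕ} (hi : i ≤ n) (hj : j ≤ n)
    (h : blockIndex r t j = blockIndex r t i + 1) (c : K) (e : Set K) :
    transfer r i j c ∈ e ↔
      transfer r i (blockEnd r t n i + 1) c ∈ {y | transfer r (blockStart r t j) j y ∈ e} := by
  have h1 := blockEnd_succ r t hi hj h
  have h2 : i ≤ blockEnd r t n i := le_blockEnd r t hi rfl
  rw [transfer_comp_apply r (h2.trans (Nat.le_add_right _ 1)) (h1.trans_le (blockStart_le r t j)), h1]
  rfl

end Blocks

/-! ### Linear NLC-expressions as words of maps -/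

/-- A graph whose vertices are the positions of a word of maps on colours: the `i`-th vertex gets an
initial colour, the `j`-th map is applied to all the colours present after adding the `j`-th vertex,
and the `j`-th vertex is joined to the previous vertices whose current colour is in a given set. -/
structure WordRepresentation {V : Type*} (G : SimpleGraph V) (K : Type*) where
  r : ℕ → K → K
  pos : V → ℕ
  c : V → K
  e : V → Set K
  injective : Function.Injective pos
  exists_pos : ∀ v, ∀ i ≤ pos v, ∃ u, pos u = i
  adj_iff : ∀ u v, pos u < pos v → (G.Adj u v ↔ transfer r (pos u) (pos v) (c u) ∈ e v)

/-- Induction on the last letter, which changes the data only at its own vertex and position. Absent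
vertices carry junk positions, so the invariant also records that they have no colour and no edges.
-/
theorem foldl_extend_representation {k : ℕ} {V : Type*} [Nonempty (Fin k)]
    (α : List (Letter k V)) (hα : Admissible α) :
    ∃ (r : ℕ → Fin k → Fin k) (pos : V → ℕ) (c : V → Fin k) (e : V → Set (Fin k)),
      (∀ v, v ∉ α.map Letter.v → (α.foldl ColoredGraph.extend ⟨fun _ => none, ⊥⟩).color v = none) ∧
      (∀ v ∈ α.map Letter.v, pos v < α.length ∧
        (α.foldl ColoredGraph.extend ⟨fun _ => none, ⊥⟩).color v =
          some (transfer r (pos v) α.length (c v))) ∧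
      (∀ u ∈ α.map Letter.v, ∀ v ∈ α.map Letter.v, pos u = pos v → u = v) ∧
      (∀ i < α.length, ∃ u ∈ α.map Letter.v, pos u = i) ∧
      (∀ u v, (α.foldl ColoredGraph.extend ⟨fun _ => none, ⊥⟩).graph.Adj u v →
        u ∈ α.map Letter.v) ∧
      (∀ u ∈ α.map Letter.v, ∀ v ∈ α.map Letter.v, pos u < pos v →
        ((α.foldl ColoredGraph.extend ⟨fun _ => none, ⊥⟩).graph.Adj u v ↔
          transfer r (pos u) (pos v) (c u) ∈ e v)) := by
  classical
  induction α using List.reverseRecOn with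
  | nil =>
    exact ⟨fun _ => id, fun _ => 0, fun _ => Classical.arbitrary _, fun _ => ∅, by simp⟩
  | append_singleton α a ih =>
    have hα' : Admissible α ∧ a.v ∉ α.map Letter.v := by
      unfold Admissible at hα ⊢
      rw [List.map_append, List.nodup_append] at hα
      refine ⟨hα.1, fun h => hα.2.2 _ h a.v (by simp) rfl⟩
    obtain ⟨r, pos, c, e, h1, h2, h3, h4, h5, h6⟩ := ih hα'.1
    have hav := hα'.2
    set X : ColoredGraph k V := α.foldl ColoredGraph.extend ⟨fun _ => none, ⊥⟩ with hX
    have hne : ∀ v ∈ α.map Letter.v, v ≠ a.v := fun v hv h => hav (h ▸ hv)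
    have hfold : (α ++ [a]).foldl ColoredGraph.extend ⟨fun _ => none, ⊥⟩ = X.extend a := by
      rw [List.foldl_append]; rfl
    have htr : ∀ i j, j ≤ α.length →
        transfer (Function.update r α.length a.r) i j = transfer r i j := by
      intro i j hj
      exact transfer_congr fun m hm => Function.update_of_ne (by omega) _ _
    have hmem : ∀ v, v ∈ (α ++ [a]).map Letter.v ↔ v ∈ α.map Letter.v ∨ v = a.v := by
      intro v; simp
    have hlen : (α ++ [a]).length = α.length + 1 := by simp
    have hna : ∀ w, ¬ X.graph.Adj w a.v := fun w hw => hav (h5 _ _ hw.symm)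
    refine ⟨Function.update r α.length a.r, Function.update pos a.v α.length,
      Function.update c a.v a.c, Function.update e a.v a.e, ?_⟩
    rw [hfold, hlen]
    simp only [hmem]
    refine ⟨?_, ?_, ?_, ?_, ?_, ?_⟩
    · intro v hv
      rw [not_or] at hv
      simp [ColoredGraph.extend, hv.2, h1 v hv.1]
    · rintro v (hv | rfl)
      · have := h2 v hv
        rw [Function.update_of_ne (hne v hv), Function.update_of_ne (hne v hv)]
        refine ⟨by omega, ?_⟩
        rw [transfer_succ _ this.1.le, htr _ _ le_rfl]
        simp [ColoredGraph.extend, hne v hv, this.2]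
      · simp [ColoredGraph.extend, transfer_succ, transfer_of_le]
    · rintro u (hu | rfl) v (hv | rfl) h
      · rw [Function.update_of_ne (hne u hu), Function.update_of_ne (hne v hv)] at h
        exact h3 u hu v hv h
      · rw [Function.update_of_ne (hne u hu), Function.update_self] at h
        have := (h2 u hu).1; omega
      · rw [Function.update_of_ne (hne v hv), Function.update_self] at h
        have := (h2 v hv).1; omega
      · rfl
    · intro i hi
      rcases Nat.lt_succ_iff_lt_or_eq.1 hi with hi | rfl
      · obtain ⟨u, hu, h⟩ := h4 i hi
        exact ⟨u, .inl hu, by rw [Function.update_of_ne (hne u hu), h]⟩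
      · exact ⟨a.v, .inr rfl, Function.update_self ..⟩
    · intro u v h
      simp only [ColoredGraph.extend, SimpleGraph.sup_adj, SimpleGraph.fromRel_adj] at h
      rcases h with h | ⟨-, ⟨h, -⟩ | ⟨-, i, -, h⟩⟩
      · exact .inl (h5 u v h)
      · exact .inr h
      · by_contra hc
        rw [not_or] at hc
        rw [h1 u hc.1] at h
        cases h
    · rintro u (hu | rfl) v (hv | rfl) h
      · rw [Function.update_of_ne (hne u hu), Function.update_of_ne (hne v hv)] at h
        rw [Function.update_of_ne (hne u hu), Function.update_of_ne (hne v hv),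
          Function.update_of_ne (hne u hu), Function.update_of_ne (hne v hv),
          htr _ _ (h2 v hv).1.le, ← h6 u hu v hv h]
        simp [ColoredGraph.extend, hne u hu, hne v hv]
      · rw [Function.update_of_ne (hne u hu), Function.update_of_ne (hne u hu),
          Function.update_self, Function.update_self, htr _ _ le_rfl]
        simp [ColoredGraph.extend, hne u hu, hna, (h2 u hu).2]
      · rw [Function.update_of_ne (hne v hv), Function.update_self] at h
        have := (h2 v hv).1; omega
      · exact absurd h (lt_irrefl _)

/-- The first letter of an expression does not recolour; giving it the identity map makes it an
ordinary extension of the empty graph. -/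
theorem exists_foldl_extend_eq_xi {k : ℕ} {V : Type*} (α : List (Letter k V)) :
    ∃ α' : List (Letter k V), α'.map Letter.v = α.map Letter.v ∧
      α'.foldl ColoredGraph.extend ⟨fun _ => none, ⊥⟩ = xi α := by
  cases α with
  | nil => exact ⟨[], rfl, rfl⟩
  | cons a l =>
    refine ⟨{ a with r := id } :: l, rfl, ?_⟩
    rw [List.foldl_cons, xi]
    congr 1
    simp only [ColoredGraph.extend, ColoredGraph.single, Option.map_id, id]
    congr 1
    ext u v
    simp

theorem HasLinearNLCExpression.exists_wordRepresentation {V : Type*} {G : SimpleGraph V} {k : ℕ}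
    (h : HasLinearNLCExpression G k) : Nonempty (WordRepresentation G (Fin k)) := by
  obtain ⟨α, hα, hcol, rfl⟩ := h
  obtain ⟨α', hv, hxi⟩ := exists_foldl_extend_eq_xi α
  have hα' : Admissible α' := by unfold Admissible at hα ⊢; rwa [hv]
  -- Without vertices there may be no colours at all; with a vertex, its final colour shows that
  -- `Fin k` is nonempty.
  rcases isEmpty_or_nonempty V with hV | ⟨⟨w⟩⟩
  · exact ⟨⟨fun _ => id, isEmptyElim, isEmptyElim, isEmptyElim, fun u => isEmptyElim u,
      fun u => isEmptyElim u, fun u => isEmptyElim u⟩⟩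
  · obtain ⟨x, -⟩ := Option.ne_none_iff_exists.1 (hcol w)
    have : Nonempty (Fin k) := ⟨x⟩
    obtain ⟨r, pos, c, e, h1, h2, h3, h4, h5, h6⟩ := foldl_extend_representation α' hα'
    rw [hxi] at h1 h2 h5 h6
    have hall : ∀ v, v ∈ α'.map Letter.v := fun v => by
      by_contra hc; exact hcol v (h1 v hc)
    refine ⟨⟨r, pos, c, e, fun u v h => h3 u (hall u) v (hall v) h, fun v i hi => ?_,
      fun u v h => h6 u (hall u) v (hall v) h⟩⟩
    obtain ⟨u, -, hu⟩ := h4 i (hi.trans_lt (h2 v (hall v)).1)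
    exact ⟨u, hu⟩

/-- Enlarging the set of colours. -/
theorem WordRepresentation.exists_extend {V : Type*} {G : SimpleGraph V} {K K' : Type*}
    (W : WordRepresentation G K) (f : K → K') (hf : Function.Injective f) [Nonempty K'] :
    Nonempty (WordRepresentation G K') := by
  rcases isEmpty_or_nonempty V with hV | ⟨⟨w⟩⟩
  · exact ⟨⟨fun _ => id, isEmptyElim, isEmptyElim, isEmptyElim, fun u => isEmptyElim u,
      fun u => isEmptyElim u, fun u => isEmptyElim u⟩⟩
  · have : Nonempty K := ⟨W.c w⟩
    have htr : ∀ i j x, transfer (fun m => f ∘ W.r m ∘ Function.invFun f) i j (f x) =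
        f (transfer W.r i j x) := by
      intro i j x
      induction j with
      | zero => rfl
      | succ j ih =>
        simp only [transfer]
        split_ifs with h
        · simp only [Function.comp_apply, ih, Function.leftInverse_invFun hf _]
        · rfl
    refine ⟨⟨fun m => f ∘ W.r m ∘ Function.invFun f, W.pos, fun v => f (W.c v),
      fun v => f '' W.e v, W.injective, W.exists_pos, fun u v h => ?_⟩⟩
    rw [W.adj_iff u v h, htr, hf.mem_set_image]

/-- The strict bound by `k + 1` extracts a witness from the infimum; padding to exactly `k + 1`
colours gives one nonempty palette for the whole class. -/
theorem exists_wordRepresentation_of_width_le {V : Type*} {G : SimpleGraph V} {k : ℕ}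
    (h : linearNLCWidth G ≤ k) : Nonempty (WordRepresentation G (Fin (k + 1))) := by
  have h' : linearNLCWidth G < ((k + 1 : ℕ) : ℕ∞) :=
    h.trans_lt (by exact_mod_cast Nat.lt_succ_self k)
  simp only [linearNLCWidth, iInf_lt_iff] at h'
  obtain ⟨k', hk', hlt⟩ := h'
  have hlt : k' < k + 1 := by exact_mod_cast hlt
  obtain ⟨W⟩ := hk'.exists_wordRepresentation
  exact W.exists_extend (Fin.castLE hlt.le) (Fin.castLE_injective hlt.le)

/-! ### Determining directions in the absence of half-graphs -/

section Chains

variable {V Γ Λ : Type*} (grp : V → Γ) (lab : V → Λ) (b : V → ℕ)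

/-- There is an alternating sequence `x₀, y₀, …, xₘ₋₁, yₘ₋₁` of vertices of the group `g`, with
labels `α` and `β`, whose blocks are increasing and pairwise not consecutive, and all precede the
block `s`, but not immediately. -/
def HasChain (g : Γ) (α β : Λ) (m s : ℕ) : Prop :=
  ∃ x y : ℕ → V,
    (∀ i < m, grp (x i) = g ∧ grp (y i) = g ∧ lab (x i) = α ∧ lab (y i) = β ∧
      b (x i) + 2 ≤ b (y i) ∧ b (y i) + 2 ≤ s) ∧
    ∀ i j, i < j → j < m → b (y i) + 2 ≤ b (x j)

variable {grp lab b}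

theorem HasChain.mono {g : Γ} {α β : Λ} {m s s' : ℕ} (h : HasChain grp lab b g α β m s)
    (hs : s ≤ s') : HasChain grp lab b g α β m s' := by
  obtain ⟨x, y, h1, h2⟩ := h
  refine ⟨x, y, fun i hi => ?_, h2⟩
  obtain ⟨a1, a2, a3, a4, a5, a6⟩ := h1 i hi
  exact ⟨a1, a2, a3, a4, a5, a6.trans hs⟩

theorem HasChain.snoc {g : Γ} {α β : Λ} {m : ℕ} {u v : V} (h : HasChain grp lab b g α β m (b u))
    (hu : grp u = g) (hv : grp v = g) (hα : lab u = α) (hβ : lab v = β)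
    (huv : b u + 2 ≤ b v) : HasChain grp lab b g α β (m + 1) (b v + 2) := by
  obtain ⟨x, y, h1, h2⟩ := h
  refine ⟨Function.update x m u, Function.update y m v, fun i hi => ?_, fun i j hij hj => ?_⟩
  · rcases Nat.lt_succ_iff_lt_or_eq.1 hi with hi | rfl
    · rw [Function.update_of_ne hi.ne, Function.update_of_ne hi.ne]
      obtain ⟨a1, a2, a3, a4, a5, a6⟩ := h1 i hi
      exact ⟨a1, a2, a3, a4, a5, by omega⟩
    · simp only [Function.update_self]
      exact ⟨hu, hv, hα, hβ, huv, le_rfl⟩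
  · rcases Nat.lt_succ_iff_lt_or_eq.1 hj with hj | rfl
    · rw [Function.update_of_ne hj.ne, Function.update_of_ne (hij.trans hj).ne]
      exact h2 i j hij hj
    · rw [Function.update_self, Function.update_of_ne hij.ne]
      exact (h1 i hij).2.2.2.2.2

/-- For `i ≤ j` the vertex `x i` lies far before `y j`, so `F α β` makes them adjacent; for `j < i`
the order is reversed and `F β α` fails. -/
theorem HasChain.isSemiInduced {G : SimpleGraph V} {F : Λ → Λ → Prop}
    (hF : ∀ u v, grp u = grp v → b u + 2 ≤ b v → (G.Adj u v ↔ F (lab u) (lab v)))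
    {g : Γ} {α β : Λ} {m s : ℕ} (h1 : F α β) (h2 : ¬ F β α)
    (h : HasChain grp lab b g α β m s) : IsSemiInduced (halfGraph m) G := by
  obtain ⟨x, y, hxy, hlt⟩ := h
  have hle : ∀ i j, i ≤ j → j < m → b (x i) + 2 ≤ b (y j) := by
    intro i j hij hj
    rcases hij.lt_or_eq with h | rfl
    · have := hlt i j h hj
      have := (hxy i (h.trans hj)).2.2.2.2.1
      have := (hxy j hj).2.2.2.2.1
      omega
    · exact (hxy i hj).2.2.2.2.1
  refine ⟨⟨Sum.elim (fun i => x i) (fun i => y i), ?_⟩, fun i j => ?_⟩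
  · rintro (i | i) (j | j) hij <;>
      simp only [Sum.elim_inl, Sum.elim_inr, Sum.inl.injEq, Sum.inr.injEq, reduceCtorEq] at hij ⊢
    · by_contra hne
      have hne' : (i : ℕ) ≠ j := fun h => hne (Fin.ext h)
      rcases hne'.lt_or_gt with h | h
      · have a1 := hlt i j h j.2
        have a2 := hle i i le_rfl i.2
        rw [hij] at a2; omega
      · have a1 := hlt j i h i.2
        have a2 := hle j j le_rfl j.2
        rw [hij] at a1; omega
    · rcases le_or_gt (i : ℕ) j with h | h
      · have := hle i j h j.2; rw [hij] at this; omega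
      · have := hlt j i h i.2; rw [hij] at this; omega
    · rcases le_or_gt (j : ℕ) i with h | h
      · have := hle j i h i.2; rw [hij] at this; omega
      · have := hlt i j h j.2; rw [hij] at this; omega
    · by_contra hne
      have hne' : (i : ℕ) ≠ j := fun h => hne (Fin.ext h)
      rcases hne'.lt_or_gt with h | h
      · have a1 := hlt i j h j.2
        have a2 := hle j j le_rfl j.2
        rw [hij] at a1; omega
      · have a1 := hlt j i h i.2
        have a2 := hle i i le_rfl i.2
        rw [hij] at a2; omega
  · obtain ⟨a1, -, a3, -, -, -⟩ := hxy i i.2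
    obtain ⟨-, b2, -, b4, -, -⟩ := hxy j j.2
    change G.Adj (x i) (y j) ↔ i ≤ j
    rcases le_or_gt (i : ℕ) j with h | h
    · rw [hF _ _ (a1.trans b2.symm) (hle i j h j.2), a3, b4]
      exact iff_of_true h1 (Fin.le_def.2 h)
    · rw [G.adj_comm, hF _ _ (b2.trans a1.symm) (hlt j i h i.2), a3, b4]
      exact iff_of_false h2 (not_le.2 (Fin.lt_def.2 h))

/-- If there is no half-graph of order `N`, then the direction between two far apart vertices is
determined by the lengths less than `N` of the chains that end before them. -/
theorem lt_iff_chains {G : SimpleGraph V} {F : Λ → Λ → Prop} {N : ℕ}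
    (hF : ∀ u v, grp u = grp v → b u + 2 ≤ b v → (G.Adj u v ↔ F (lab u) (lab v)))
    (hN : ¬ IsSemiInduced (halfGraph N) G) {u v : V} (hg : grp u = grp v)
    (h1 : F (lab u) (lab v)) (h2 : ¬ F (lab v) (lab u)) (hfar : b u + 2 ≤ b v ∨ b v + 2 ≤ b u) :
    b u < b v ↔ ¬ ∀ m : Fin N, HasChain grp lab b (grp v) (lab u) (lab v) m (b v + 2) →
      HasChain grp lab b (grp u) (lab u) (lab v) m (b u) := by
  rw [hg]
  constructor
  · intro hlt hsub
    have huv : b u + 2 ≤ b v := by omega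
    -- A chain fitting before `u` can be prolonged by the pair `u, v`. If every chain ending by `v`
    -- also fits before `u`, this iterates up to length `N`, starting from the empty chain.
    have key : ∀ m ≤ N, HasChain grp lab b (grp v) (lab u) (lab v) m (b v + 2) := by
      intro m
      induction m with
      | zero => intro _; exact ⟨fun _ => u, fun _ => u, by simp, by simp⟩
      | succ m ih =>
        intro hm
        exact (hsub ⟨m, hm⟩ (ih (by omega))).snoc hg rfl rfl rfl huv
    exact hN ((key N le_rfl).isSemiInduced hF h1 h2)
  · intro h
    by_contra hc
    -- If `v` comes first, then `b v + 2 ≤ b u`, so any chain ending by `v` fits before `u`.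
    exact h fun m hm => hm.mono (by omega)

end Chains

/-! ### Local descriptions -/

/-- The relative position of two blocks: equal, the first just before the second, and the second
just before the first. -/
def blockPattern (i j : ℕ) : Fin 3 → Prop :=
  ![i = j, j = i + 1, i = j + 1]

/-- The adjacencies of `G` are determined by finite labels of the vertices, and by which blocks
are equal or consecutive, for `h` partitions of a linear ordering of the vertices into blocks. -/
structure LocalDescription {V : Type*} (G : SimpleGraph V) (h : ℕ) (L : Type*)
    (Φ : L → L → (Fin h → Fin 3 → Prop) → Prop) where
  pos : V → ℕ
  block : Fin h → V → ℕ
  label : V → L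
  injective : Function.Injective pos
  block_mono : ∀ ℓ u v, pos u ≤ pos v → block ℓ u ≤ block ℓ v
  exists_block : ∀ ℓ v, ∀ β ≤ block ℓ v, ∃ u, block ℓ u = β
  adj_iff : ∀ u v, u ≠ v →
    (G.Adj u v ↔ Φ (label u) (label v) fun ℓ => blockPattern (block ℓ u) (block ℓ v))

/-- The label of a vertex with respect to a level: a label for far vertices, a label
for vertices in consecutive blocks, and the lengths of some chains. -/
abbrev LevelLabel (K : Type*) (N : ℕ) : Type _ :=
  (K × Set K) × (K × Set K) ×
    (K × Set K → K × Set K → Set (Fin N)) × (K × Set K → K × Set K → Set (Fin N))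

/-- The adjacency rule for vertices in common blocks, for vertices that are not in the same or
consecutive subblocks. -/
def farAdj {K : Type*} {N : ℕ} (a b : LevelLabel K N) : Prop :=
  (a.1.1 ∈ b.1.2 ∧ b.1.1 ∈ a.1.2) ∨
  (a.1.1 ∈ b.1.2 ∧ b.1.1 ∉ a.1.2 ∧ ¬ b.2.2.2 a.1 b.1 ⊆ a.2.2.1 a.1 b.1) ∨
  (a.1.1 ∉ b.1.2 ∧ b.1.1 ∈ a.1.2 ∧ ¬ a.2.2.2 b.1 a.1 ⊆ b.2.2.1 b.1 a.1)

/-- The adjacency rule of the local descriptions of graphs of bounded linear NLC-width. -/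
def levelAdj {K : Type*} {N k : ℕ} (a b : Fin k → LevelLabel K N)
    (P : Fin (k + 1) → Fin 3 → Prop) : Prop :=
  ∃ t : Fin k, P t.castSucc 0 ∧ ¬ P t.succ 0 ∧
    ((P t.succ 1 ∧ (a t).2.1.1 ∈ (b t).2.1.2) ∨ (P t.succ 2 ∧ (b t).2.1.1 ∈ (a t).2.1.2) ∨
      (¬ P t.succ 1 ∧ ¬ P t.succ 2 ∧ farAdj (a t) (b t)))

namespace WordRepresentation

variable {V : Type*} {G : SimpleGraph V} {K : Type*} (W : WordRepresentation G K)

/-- The index of the block of level `t` of a vertex. -/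
noncomputable def level (t : ℕ) (v : V) : ℕ := blockIndex W.r t (W.pos v)

/-- The label for adjacencies between vertices in a common block of level `t` but in subblocks which
are neither equal nor consecutive; `n` bounds the positions of the vertices. -/
noncomputable def farLabel (n t : ℕ) (v : V) : K × Set K :=
  (transfer W.r (W.pos v) (blockEnd W.r t n (W.pos v)) (W.c v),
    {y | ∃ z ∈ Set.range (transfer W.r
          (blockStart W.r (t + 1) (blockStart W.r (t + 1) (W.pos v) - 1))
          (blockStart W.r (t + 1) (W.pos v))),
      transfer W.r (blockStart W.r (t + 1) (W.pos v)) (blockEnd W.r t n (W.pos v)) z = y ∧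
      transfer W.r (blockStart W.r (t + 1) (W.pos v)) (W.pos v) z ∈ W.e v})

/-- The label for adjacencies between vertices in consecutive blocks of level `t`. -/
noncomputable def nextLabel (n t : ℕ) (v : V) : K × Set K :=
  (transfer W.r (W.pos v) (blockEnd W.r t n (W.pos v) + 1) (W.c v),
    {y | transfer W.r (blockStart W.r t (W.pos v)) (W.pos v) y ∈ W.e v})

theorem pos_lt_of_level_lt {t : ℕ} {u v : V} (h : W.level t u < W.level t v) :
    W.pos u < W.pos v := by
  by_contra hc
  exact absurd (blockIndex_mono W.r t (not_lt.1 hc)) (not_le.2 h)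

theorem adj_iff_farLabel [Finite K] {n t : ℕ} (ht : t < Nat.card K) (hn : ∀ v, W.pos v ≤ n)
    {u v : V} (h : W.level t u = W.level t v) (hfar : W.level (t + 1) u + 2 ≤ W.level (t + 1) v) :
    G.Adj u v ↔ (W.farLabel n t u).1 ∈ (W.farLabel n t v).2 := by
  rw [W.adj_iff u v (W.pos_lt_of_level_lt (t := t + 1) (by omega))]
  exact mem_iff_of_far W.r t ht (hn v) h hfar _ _

theorem adj_iff_nextLabel {n t : ℕ} (hn : ∀ v, W.pos v ≤ n)
    {u v : V} (h : W.level t v = W.level t u + 1) :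
    G.Adj u v ↔ (W.nextLabel n t u).1 ∈ (W.nextLabel n t v).2 := by
  rw [W.adj_iff u v (W.pos_lt_of_level_lt (t := t) (by omega))]
  exact mem_iff_of_consecutive W.r t (hn u) (hn v) h _ _

/-- All the labels of a vertex. -/
noncomputable def levelLabel (n N k : ℕ) (v : V) (t : Fin k) : LevelLabel K N :=
  (W.farLabel n t v, W.nextLabel n (t + 1) v,
    fun α β => {m | HasChain (W.level t) (W.farLabel n t) (W.level (t + 1)) (W.level t v) α β m
      (W.level (t + 1) v)},
    fun α β => {m | HasChain (W.level t) (W.farLabel n t) (W.level (t + 1)) (W.level t v) α β m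
      (W.level (t + 1) v + 2)})

/-- When the two directions predict the same adjacency the order is irrelevant; in the two remaining
cases it is decided by comparing the chain lengths stored at the two vertices. -/
theorem adj_iff_farAdj [Finite K] {n N k : ℕ} (hk : k = Nat.card K) (hn : ∀ v, W.pos v ≤ n)
    (hN : ¬ IsSemiInduced (halfGraph N) G) (t : Fin k)
    {u v : V} (h : W.level t u = W.level t v)
    (hfar : W.level (t + 1) u + 2 ≤ W.level (t + 1) v ∨
      W.level (t + 1) v + 2 ≤ W.level (t + 1) u) :
    G.Adj u v ↔ farAdj (W.levelLabel n N k u t) (W.levelLabel n N k v t) := by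
  have ht : (t : ℕ) < Nat.card K := hk ▸ t.2
  have hF : ∀ u v, W.level t u = W.level t v → W.level (t + 1) u + 2 ≤ W.level (t + 1) v →
      (G.Adj u v ↔ (fun α β : K × Set K => α.1 ∈ β.2) (W.farLabel n t u) (W.farLabel n t v)) :=
    fun u v h hfar => W.adj_iff_farLabel ht hn h hfar
  have hdir := fun h1 h2 => lt_iff_chains (F := fun α β : K × Set K => α.1 ∈ β.2) hF hN h h1 h2 hfar
  have hdir' := fun h1 h2 => lt_iff_chains (F := fun α β : K × Set K => α.1 ∈ β.2) hF hN
    h.symm h1 h2 hfar.symm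
  have e1 : (W.levelLabel n N k v t).2.2.2 (W.farLabel n t u) (W.farLabel n t v) ⊆
      (W.levelLabel n N k u t).2.2.1 (W.farLabel n t u) (W.farLabel n t v) ↔
      ∀ m : Fin N, HasChain (W.level t) (W.farLabel n t) (W.level (t + 1)) (W.level t v)
        (W.farLabel n t u) (W.farLabel n t v) m (W.level (t + 1) v + 2) →
      HasChain (W.level t) (W.farLabel n t) (W.level (t + 1)) (W.level t u)
        (W.farLabel n t u) (W.farLabel n t v) m (W.level (t + 1) u) := Iff.rfl
  have e2 : (W.levelLabel n N k u t).2.2.2 (W.farLabel n t v) (W.farLabel n t u) ⊆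
      (W.levelLabel n N k v t).2.2.1 (W.farLabel n t v) (W.farLabel n t u) ↔
      ∀ m : Fin N, HasChain (W.level t) (W.farLabel n t) (W.level (t + 1)) (W.level t u)
        (W.farLabel n t v) (W.farLabel n t u) m (W.level (t + 1) u + 2) →
      HasChain (W.level t) (W.farLabel n t) (W.level (t + 1)) (W.level t v)
        (W.farLabel n t v) (W.farLabel n t u) m (W.level (t + 1) v) := Iff.rfl
  have hadj : G.Adj u v ↔
      (W.level (t + 1) u < W.level (t + 1) v ∧ (W.farLabel n t u).1 ∈ (W.farLabel n t v).2) ∨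
      (W.level (t + 1) v < W.level (t + 1) u ∧ (W.farLabel n t v).1 ∈ (W.farLabel n t u).2) := by
    rcases hfar with hf | hf
    · rw [hF u v h hf]; simp only; constructor
      · intro h; exact .inl ⟨by omega, h⟩
      · rintro (h | h)
        · exact h.2
        · omega
    · rw [G.adj_comm, hF v u h.symm hf]; simp only; constructor
      · intro h; exact .inr ⟨by omega, h⟩
      · rintro (h | h)
        · omega
        · exact h.2
  have hor : W.level (t + 1) u < W.level (t + 1) v ∨ W.level (t + 1) v < W.level (t + 1) u := by
    omega
  rw [hadj]
  change _ ↔ (((W.farLabel n t u).1 ∈ (W.farLabel n t v).2 ∧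
    (W.farLabel n t v).1 ∈ (W.farLabel n t u).2) ∨
    ((W.farLabel n t u).1 ∈ (W.farLabel n t v).2 ∧ (W.farLabel n t v).1 ∉ (W.farLabel n t u).2 ∧
      ¬ (W.levelLabel n N k v t).2.2.2 (W.farLabel n t u) (W.farLabel n t v) ⊆
      (W.levelLabel n N k u t).2.2.1 (W.farLabel n t u) (W.farLabel n t v)) ∨
    ((W.farLabel n t u).1 ∉ (W.farLabel n t v).2 ∧ (W.farLabel n t v).1 ∈ (W.farLabel n t u).2 ∧
      ¬ (W.levelLabel n N k u t).2.2.2 (W.farLabel n t v) (W.farLabel n t u) ⊆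
      (W.levelLabel n N k v t).2.2.1 (W.farLabel n t v) (W.farLabel n t u)))
  rw [e1, e2]
  by_cases p : (W.farLabel n t u).1 ∈ (W.farLabel n t v).2 <;>
    by_cases q : (W.farLabel n t v).1 ∈ (W.farLabel n t u).2
  · simp only [p, q, and_true, true_and, hor, true_or]
  · rw [← hdir p q]; simp only [p, q, and_true, and_false, or_false, not_false_iff, true_and,
      false_and, false_or, not_true]
  · rw [← hdir' q p]; simp only [p, q, and_true, and_false, not_false_iff, true_and,
      false_and, false_or, not_true]
  · simp only [p, q, and_false, false_and, or_false]

/-- Two positions that are in a common block of level `0` but in distinct blocks of level `k` are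
separated at some level. -/
theorem exists_separating_level {k : ℕ} {u v : V} (h0 : W.level 0 u = W.level 0 v)
    (hk : W.level k u ≠ W.level k v) :
    ∃ t : Fin k, W.level t u = W.level t v ∧ W.level (t + 1) u ≠ W.level (t + 1) v := by
  induction k with
  | zero => exact absurd h0 hk
  | succ k ih =>
    by_cases h : W.level k u = W.level k v
    · exact ⟨Fin.last k, h, hk⟩
    · obtain ⟨t, ht⟩ := ih h
      exact ⟨t.castSucc, ht⟩

theorem exists_localDescription (W : WordRepresentation G K) [Finite V] [Finite K] [Nonempty K] {N k : ℕ} (hk : k = Nat.card K)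
    (hN : ¬ IsSemiInduced (halfGraph N) G) :
    Nonempty (LocalDescription G (k + 1) (Fin k → LevelLabel K N) levelAdj) := by
  obtain ⟨n, hn⟩ : ∃ n, ∀ v, W.pos v ≤ n := by
    obtain ⟨n, hn⟩ := (Set.finite_range W.pos).bddAbove
    exact ⟨n, fun v => hn ⟨v, rfl⟩⟩
  refine ⟨⟨W.pos, fun ℓ v => W.level ℓ v, W.levelLabel n N k, W.injective,
    fun ℓ u v h => blockIndex_mono W.r ℓ h, fun ℓ v β hβ => ?_, fun u v huv => ?_⟩⟩
  · obtain ⟨j, hj, h⟩ := exists_blockIndex_eq W.r ℓ hβ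
    obtain ⟨u, rfl⟩ := W.exists_pos v j hj
    exact ⟨u, h⟩
  -- Every separating level gives the correct answer, so it does not matter which one the
  -- existential in `levelAdj` selects.
  · have key : ∀ t : Fin k, W.level t u = W.level t v → W.level (t + 1) u ≠ W.level (t + 1) v →
        (G.Adj u v ↔ (W.level (t + 1) v = W.level (t + 1) u + 1 ∧
            (W.nextLabel n (t + 1) u).1 ∈ (W.nextLabel n (t + 1) v).2) ∨
          (W.level (t + 1) u = W.level (t + 1) v + 1 ∧
            (W.nextLabel n (t + 1) v).1 ∈ (W.nextLabel n (t + 1) u).2) ∨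
          (¬ W.level (t + 1) v = W.level (t + 1) u + 1 ∧
            ¬ W.level (t + 1) u = W.level (t + 1) v + 1 ∧
            farAdj (W.levelLabel n N k u t) (W.levelLabel n N k v t))) := by
      intro t h h'
      by_cases h1 : W.level (t + 1) v = W.level (t + 1) u + 1
      · rw [W.adj_iff_nextLabel hn h1]
        have h2 : ¬ W.level (t + 1) u = W.level (t + 1) v + 1 := by omega
        refine ⟨fun h => .inl ⟨h1, h⟩, ?_⟩
        rintro (h | h | h)
        exacts [h.2, absurd h.1 h2, absurd h1 h.1]
      · by_cases h2 : W.level (t + 1) u = W.level (t + 1) v + 1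
        · rw [G.adj_comm, W.adj_iff_nextLabel hn h2]
          refine ⟨fun h => .inr (.inl ⟨h2, h⟩), ?_⟩
          rintro (h | h | h)
          exacts [absurd h.1 h1, h.2, absurd h2 h.2.1]
        · rw [W.adj_iff_farAdj hk hn hN t h (by omega)]
          simp only [h2, h1, true_and, false_and, not_false_iff, false_or]
    constructor
    · intro h
      obtain ⟨t, ht, ht'⟩ := W.exists_separating_level (k := k) (u := u) (v := v)
        (by simp only [level, blockIndex_zero])
        (by simp only [level, hk, blockIndex_card]; exact fun h => huv (W.injective h))
      exact ⟨t, ht, ht', (key t ht ht').1 h⟩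
    · rintro ⟨t, ht, ht', h⟩
      exact (key t ht ht').2 h

end WordRepresentation

open FirstOrder

/-! ### Pathwidth of block graphs -/

namespace LocalDescription

variable {V : Type u} {G : SimpleGraph V} {h : ℕ} {L : Type*}
  {Φ : L → L → (Fin h → Fin 3 → Prop) → Prop} (D : LocalDescription G h L Φ)

/-- The blocks of all the levels. -/
abbrev Hub : Type := {p : Fin h × ℕ // ∃ v, D.block p.1 v = p.2}

/-- The hub of a vertex at some level. -/
def hub (ℓ : Fin h) (v : V) : D.Hub := ⟨(ℓ, D.block ℓ v), v, rfl⟩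

/-- The graph obtained by attaching to every vertex the blocks that contain it, and by joining
consecutive blocks of the same level. -/
def hubGraph : SimpleGraph (V ⊕ ULift.{u} D.Hub) where
  Adj
    | .inl v, .inr p => D.block p.down.1.1 v = p.down.1.2
    | .inr p, .inl v => D.block p.down.1.1 v = p.down.1.2
    | .inr p, .inr q => p.down.1.1 = q.down.1.1 ∧
        (q.down.1.2 = p.down.1.2 + 1 ∨ p.down.1.2 = q.down.1.2 + 1)
    | .inl _, .inl _ => False
  symm := ⟨by
    rintro (u | p) (v | q) h
    · exact h
    · exact h
    · exact h
    · exact ⟨h.1.symm, h.2.symm⟩⟩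
  loopless := ⟨by
    rintro (u | p) h
    · exact h
    · rcases h.2 with h | h <;> omega⟩

instance [Finite V] : Finite D.Hub := by
  have : Finite (Fin h × V) := inferInstance
  refine Finite.of_surjective (fun p : Fin h × V => D.hub p.1 p.2) ?_
  rintro ⟨⟨ℓ, β⟩, v, hv⟩
  simp only at hv
  subst hv
  exact ⟨(ℓ, v), rfl⟩

/-- The left endpoints of an interval representation. -/
noncomputable def left : V ⊕ ULift.{u} D.Hub → ℝ
  | .inl v => ({u | D.pos u < D.pos v}.ncard : ℕ)
  | .inr p => ({u | D.block p.down.1.1 u < p.down.1.2}.ncard : ℕ)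

/-- The right endpoints of an interval representation. -/
noncomputable def right : V ⊕ ULift.{u} D.Hub → ℝ
  | .inl v => ({u | D.pos u < D.pos v}.ncard : ℕ)
  | .inr p => ({u | D.block p.down.1.1 u < p.down.1.2 + 1}.ncard : ℕ)

/-- A colouring of the interval supergraph. -/
def hubColor : V ⊕ ULift.{u} D.Hub → Option (Fin h × ZMod 2)
  | .inl _ => none
  | .inr p => some (p.down.1.1, (p.down.1.2 : ZMod 2))

theorem lt_of_block_lt {ℓ : Fin h} {u v : V} (hlt : D.block ℓ u < D.block ℓ v) :
    D.pos u < D.pos v := by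
  by_contra hc
  exact absurd (D.block_mono ℓ v u (not_lt.1 hc)) (not_le.2 hlt)

/-- Each vertex becomes the point given by its rank in the linear order, and each block the interval
spanned between the ranks at its two boundaries. Consecutive blocks share an endpoint. A proper
colouring of the intersection graph with `2 * h + 1` colours then bounds its cliques. -/
theorem pathwidth_hubGraph_le [Finite V] : pathwidth D.hubGraph ≤ (2 * h : ℕ) := by
  have hle : ∀ x, D.left x ≤ D.right x := by
    rintro (v | p)
    · exact le_rfl
    · simp only [left, right, Nat.cast_le]
      exact Set.ncard_le_ncard fun u hu => Nat.lt_succ_of_lt (Set.mem_ofPred.1 hu)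
  have hin : ∀ v (p : ULift.{u} D.Hub), D.block p.down.1.1 v = p.down.1.2 →
      D.left (.inr p) ≤ D.left (.inl v) ∧ D.left (.inl v) ≤ D.right (.inr p) := by
    intro v p hv
    simp only [left, right, Nat.cast_le, ← hv]
    constructor
    · exact Set.ncard_le_ncard fun u hu => D.lt_of_block_lt hu
    · exact Set.ncard_le_ncard fun u hu =>
        Nat.lt_succ_of_le (D.block_mono _ _ _ (Set.mem_ofPred.1 hu).le)
  have hcons : ∀ p q : ULift.{u} D.Hub, p.down.1.1 = q.down.1.1 → q.down.1.2 = p.down.1.2 + 1 →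
      D.right (.inr p) = D.left (.inr q) := by
    intro p q h1 h2
    simp only [left, right, h1, h2]
  have hsep : ∀ p q : ULift.{u} D.Hub, p.down.1.1 = q.down.1.1 →
      p.down.1.2 + 2 ≤ q.down.1.2 → D.right (.inr p) < D.left (.inr q) := by
    rintro ⟨⟨⟨ℓ, β⟩, _⟩⟩ ⟨⟨⟨ℓ', β'⟩, w, hw⟩⟩ h1 h2
    simp only at h1 h2 hw
    subst h1
    simp only [left, right, Nat.cast_lt]
    -- The block in between is nonempty, which makes the two intervals disjoint.
    obtain ⟨u, hu⟩ := D.exists_block ℓ w (β + 1) (by omega)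
    refine Set.ncard_lt_ncard ⟨fun x hx => ?_, fun hc => ?_⟩
    · exact (Set.mem_ofPred.1 hx).trans_le (by omega)
    · have : D.block ℓ u < β + 1 := hc (show D.block ℓ u < β' by omega)
      omega
  have hpt : ∀ u v, D.pos u < D.pos v → D.left (.inl u) < D.left (.inl v) := by
    intro u v huv
    simp only [left, Nat.cast_lt]
    refine Set.ncard_lt_ncard ⟨fun x hx => (Set.mem_ofPred.1 hx).trans huv, fun hc => ?_⟩
    exact lt_irrefl (D.pos u) (hc huv)
  set H : SimpleGraph (V ⊕ ULift.{u} D.Hub) :=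
    intersectionGraph fun x => Set.Icc (D.left x) (D.right x) with hH
  have hsub : D.hubGraph ≤ H := by
    rintro x y hxy
    refine ⟨hxy.ne, ?_⟩
    rcases x with u | p <;> rcases y with v | q
    · exact hxy.elim
    · exact ⟨D.left (.inl u), ⟨le_rfl, hle _⟩, hin u q hxy⟩
    · exact ⟨D.left (.inl v), hin v p hxy, ⟨le_rfl, hle _⟩⟩
    · rcases hxy.2 with h2 | h2
      · have := hcons p q hxy.1 h2
        exact ⟨D.right (.inr p), ⟨hle _, le_rfl⟩, this.ge, this.le.trans (hle _)⟩
      · have := hcons q p hxy.1.symm h2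
        exact ⟨D.right (.inr q), ⟨this.ge, this.le.trans (hle _)⟩, ⟨hle _, le_rfl⟩⟩
  -- One colour suffices for the distinct points, and two per level for the blocks: distinct blocks
  -- of one level with equal parity are at least two apart, hence disjoint.
  let col : H.Coloring (Option (Fin h × ZMod 2)) := SimpleGraph.Coloring.mk D.hubColor (by
    rintro x y ⟨hne, z, ⟨hz1, hz2⟩, hz3, hz4⟩ hc
    rcases x with u | p <;> rcases y with v | q <;>
      simp only [hubColor, Option.some.injEq, Prod.mk.injEq, reduceCtorEq] at hc
    · have huv : D.pos u ≠ D.pos v := fun e => hne (congrArg _ (D.injective e))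
      have e : D.left (.inl u) = D.left (.inl v) :=
        (le_antisymm hz2 hz1).symm.trans (le_antisymm hz4 hz3)
      rcases huv.lt_or_gt with h1 | h1
      · exact (hpt _ _ h1).ne e
      · exact (hpt _ _ h1).ne' e
    · obtain ⟨h1, h2⟩ := hc
      rw [ZMod.natCast_eq_natCast_iff'] at h2
      have h3 : p.down.1.2 ≠ q.down.1.2 := fun e =>
        hne (congrArg _ (ULift.down_injective (Subtype.ext (Prod.ext h1 e))))
      rcases h3.lt_or_gt with h4 | h4
      · exact absurd (hz3.trans hz2) (not_le.2 (hsep p q h1 (by omega)))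
      · exact absurd (hz1.trans hz4) (not_le.2 (hsep q p h1.symm (by omega))))
  have hclique : H.cliqueNum ≤ 2 * h + 1 := by
    have h1 : (H.cliqueNum : ℕ∞) ≤ ((2 * h + 1 : ℕ) : ℕ∞) := by
      refine H.cliqueNum_le_chromaticNumber.trans ?_
      have := col.colorable.chromaticNumber_le
      simpa [mul_comm] using this
    exact_mod_cast h1
  calc pathwidth D.hubGraph ≤ (H.cliqueNum : ℤ) - 1 := by
        refine csInf_le ⟨-1, ?_⟩ ⟨H, hsub, ⟨_, _, hle, hH⟩, rfl⟩
        rintro w ⟨H', -, -, rfl⟩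
        omega
    _ ≤ (2 * h : ℕ) := by push_cast; omega

end LocalDescription

/-! ### Definability by first-order formulas, uniformly in the structure -/

/-- A property of tuples of vertices of graphs with unary predicates is first-order definable. -/
def IsDefinable {κ α : Type} (Q : ∀ {M : Type u}, SimpleGraph M → (κ → Set M) → (α → M) → Prop) :
    Prop :=
  ∃ φ : (Language.graph.sum (monadic κ)).Formula α, ∀ (M : Type u) (G : SimpleGraph M)
    (P : κ → Set M) (x : α → M), letI := monadicLift G P; φ.Realize x ↔ Q G P x

section Definable

variable {κ α : Type}

/-- The unary relation symbol `i`. -/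
def markRel (i : κ) : (Language.graph.sum (monadic κ)).Relations 1 := Sum.inr (MonadicRel.mark i)

/-- The adjacency symbol. -/
def adjRel (κ : Type) : (Language.graph.sum (monadic κ)).Relations 2 := Sum.inl Language.adj

theorem isDefinable_mark (i : κ) (a : α) :
    IsDefinable.{u} (κ := κ) (fun _ P x => x a ∈ P i) := by
  refine ⟨(markRel i).formula ![Language.Term.var a], fun M G P x => ?_⟩
  let := monadicLift G P
  exact Language.Formula.realize_rel

theorem isDefinable_adj (a b : α) :
    IsDefinable.{u} (κ := κ) (fun G _ x => G.Adj (x a) (x b)) := by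
  refine ⟨(adjRel κ).formula ![Language.Term.var a, Language.Term.var b], fun M G P x => ?_⟩
  let := monadicLift G P
  exact Language.Formula.realize_rel

theorem isDefinable_eq (a b : α) :
    IsDefinable.{u} (κ := κ) (fun _ _ x => x a = x b) := by
  refine ⟨(Language.Term.var a).equal (Language.Term.var b), fun M G P x => ?_⟩
  let := monadicLift G P
  exact Language.Formula.realize_equal

variable {Q Q' : ∀ {M : Type u}, SimpleGraph M → (κ → Set M) → (α → M) → Prop}

theorem IsDefinable.and (h : IsDefinable.{u} Q) (h' : IsDefinable.{u} Q') :
    IsDefinable.{u} (fun G P x => Q G P x ∧ Q' G P x) := by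
  obtain ⟨φ, hφ⟩ := h
  obtain ⟨ψ, hψ⟩ := h'
  refine ⟨φ ⊓ ψ, fun M G P x => ?_⟩
  let := monadicLift G P
  rw [Language.Formula.realize_inf, hφ, hψ]

theorem IsDefinable.exists {β : Type} [Finite β]
    {Q : ∀ {M : Type u}, SimpleGraph M → (κ → Set M) → (α ⊕ β → M) → Prop}
    (h : IsDefinable.{u} Q) :
    IsDefinable.{u} (fun {M} G P (x : α → M) => ∃ y : β → M, Q G P (Sum.elim x y)) := by
  obtain ⟨φ, hφ⟩ := h
  refine ⟨φ.iExs β, fun M G P x => ?_⟩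
  let := monadicLift G P
  rw [Language.Formula.realize_iExs]
  exact exists_congr fun y => hφ M G P _

/-- Disjunctive normal form over the finitely many truth assignments satisfying `g`. It lets the
adjacency rule be an arbitrary predicate, with no explicit formula for it. -/
theorem IsDefinable.boolean {ι : Type*} [Finite ι]
    {Q : ι → ∀ {M : Type u}, SimpleGraph M → (κ → Set M) → (α → M) → Prop}
    (h : ∀ i, IsDefinable.{u} (Q i)) (g : (ι → Prop) → Prop) :
    IsDefinable.{u} (fun G P x => g fun i => Q i G P x) := by
  classical
  choose φ hφ using h
  refine ⟨Language.Formula.iSup fun σ : {σ : ι → Prop // g σ} =>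
    Language.Formula.iInf fun i => if σ.1 i then φ i else (φ i).not, fun M G P x => ?_⟩
  let := monadicLift G P
  rw [Language.Formula.realize_iSup]
  simp only [Language.Formula.realize_iInf]
  have key : ∀ (σ : ι → Prop) i,
      (if σ i then φ i else (φ i).not).Realize x ↔ (σ i ↔ Q i G P x) := by
    intro σ i
    split_ifs with hc
    · rw [hφ i]; simp [hc]
    · rw [Language.Formula.realize_not, hφ i]; simp [hc]
  simp only [key]
  constructor
  · rintro ⟨σ, hσ⟩
    have : σ.1 = fun i => Q i G P x := funext fun i => propext (hσ i)
    rw [← this]; exact σ.2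
  · intro hg
    exact ⟨⟨_, hg⟩, fun i => Iff.rfl⟩

end Definable

/-! ### Interpreting a graph in its graph of blocks -/

section Formulas

variable {κ : Type} {L : Type} {h : ℕ} (e : L ⊕ (Fin h × ZMod 3) → κ)

/-- The first-order properties of pairs of vertices from which adjacency is recovered: the labels,
being in a common block, and being in consecutive blocks. -/
def pairProperty (i : (L × Fin 2) ⊕ (Fin h × ZMod 3) ⊕ (Fin h × ZMod 3 × Fin 2))
    {M : Type u} (G : SimpleGraph M) (P : κ → Set M) (x : Fin 2 → M) : Prop :=
  match i with
  | .inl (τ, a) => x a ∈ P (e (.inl τ))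
  | .inr (.inl (ℓ, s)) => ∃ y : Unit → M,
      (G.Adj (x 0) (y ()) ∧ G.Adj (x 1) (y ())) ∧ y () ∈ P (e (.inr (ℓ, s)))
  | .inr (.inr (ℓ, s, a)) => ∃ y : Fin 2 → M,
      ((G.Adj (x a) (y 0) ∧ G.Adj (x (1 - a)) (y 1)) ∧ G.Adj (y 0) (y 1)) ∧
        (y 0 ∈ P (e (.inr (ℓ, s))) ∧ y 1 ∈ P (e (.inr (ℓ, s + 1))))

theorem isDefinable_pairProperty (i) : IsDefinable.{u} (pairProperty e i) := by
  rcases i with ⟨τ, a⟩ | ⟨ℓ, s⟩ | ⟨ℓ, s, a⟩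
  · exact isDefinable_mark _ _
  · exact (((isDefinable_adj (.inl (0 : Fin 2)) (.inr ())).and
      (isDefinable_adj (.inl 1) (.inr ()))).and (isDefinable_mark (e (.inr (ℓ, s))) (.inr ()))).exists
  · exact ((((isDefinable_adj (.inl a) (.inr (0 : Fin 2))).and
      (isDefinable_adj (.inl (1 - a)) (.inr 1))).and (isDefinable_adj (.inr 0) (.inr 1))).and
      ((isDefinable_mark (e (.inr (ℓ, s))) (.inr 0)).and
        (isDefinable_mark (e (.inr (ℓ, s + 1))) (.inr 1)))).exists

end Formulas

namespace LocalDescription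

variable {V : Type u} {G : SimpleGraph V} {h : ℕ} {L : Type}
  {Φ : L → L → (Fin h → Fin 3 → Prop) → Prop} (D : LocalDescription G h L Φ)

/-- The unary predicates on the graph of blocks: the labels of the vertices, and the levels and
residues modulo `3` of the blocks. -/
def mark : L ⊕ (Fin h × ZMod 3) → Set (V ⊕ ULift.{u} D.Hub)
  | .inl τ => Sum.inl '' {v | D.label v = τ}
  | .inr (ℓ, s) => Sum.inr '' {p | p.down.1.1 = ℓ ∧ (p.down.1.2 : ZMod 3) = s}

theorem inl_mem_mark_inl {v : V} {τ : L} :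
    (.inl v : V ⊕ ULift.{u} D.Hub) ∈ D.mark (.inl τ) ↔ D.label v = τ := by
  simp [mark]

theorem inl_notMem_mark_inr {v : V} {i : Fin h × ZMod 3} :
    (.inl v : V ⊕ ULift.{u} D.Hub) ∉ D.mark (.inr i) := by
  simp [mark]

theorem inr_notMem_mark_inl {p : ULift.{u} D.Hub} {τ : L} : .inr p ∉ D.mark (.inl τ) := by
  simp [mark]

theorem inr_mem_mark_inr {p : ULift.{u} D.Hub} {ℓ : Fin h} {s : ZMod 3} :
    .inr p ∈ D.mark (.inr (ℓ, s)) ↔ p.down.1.1 = ℓ ∧ (p.down.1.2 : ZMod 3) = s := by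
  simp [mark]

variable {κ : Type} (e : L ⊕ (Fin h × ZMod 3) ≃ κ)

theorem exists_pairProperty_same (ℓ : Fin h) (x : Fin 2 → V) :
    (∃ s, pairProperty e (.inr (.inl (ℓ, s))) D.hubGraph (fun i => D.mark (e.symm i))
      (fun i => .inl (x i))) ↔ D.block ℓ (x 0) = D.block ℓ (x 1) := by
  simp only [pairProperty, Equiv.symm_apply_apply]
  constructor
  · rintro ⟨s, y, ⟨h1, h2⟩, h3⟩
    generalize y () = z at h1 h2 h3
    rcases z with w | p
    · exact absurd h3 D.inl_notMem_mark_inr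
    · obtain ⟨rfl, -⟩ := D.inr_mem_mark_inr.1 h3
      exact Eq.trans h1 (Eq.symm h2)
  · intro h1
    exact ⟨(D.block ℓ (x 0) : ZMod 3), fun _ => .inr ⟨D.hub ℓ (x 0)⟩, ⟨rfl, h1.symm⟩,
      D.inr_mem_mark_inr.2 ⟨rfl, rfl⟩⟩

/-- Hub edges are undirected; residues modulo 3 orient them, since a predecessor never has the
residue of a successor. -/
theorem exists_pairProperty_next (ℓ : Fin h) (x : Fin 2 → V) (a : Fin 2) :
    (∃ s, pairProperty e (.inr (.inr (ℓ, s, a))) D.hubGraph (fun i => D.mark (e.symm i))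
      (fun i => .inl (x i))) ↔ D.block ℓ (x (1 - a)) = D.block ℓ (x a) + 1 := by
  simp only [pairProperty, Equiv.symm_apply_apply]
  constructor
  · rintro ⟨s, y, ⟨⟨h1, h2⟩, h3⟩, h4, h5⟩
    generalize y 0 = z at h1 h3 h4
    generalize y 1 = z' at h2 h3 h5
    rcases z with w | p
    · exact absurd h4 D.inl_notMem_mark_inr
    rcases z' with w | q
    · exact absurd h5 D.inl_notMem_mark_inr
    obtain ⟨hp, hs⟩ := D.inr_mem_mark_inr.1 h4
    obtain ⟨hq, hs'⟩ := D.inr_mem_mark_inr.1 h5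
    have h1 : D.block p.down.1.1 (x a) = p.down.1.2 := h1
    have h2 : D.block q.down.1.1 (x (1 - a)) = q.down.1.2 := h2
    rw [hp] at h1
    rw [hq] at h2
    rw [h1, h2]
    rcases h3.2 with h6 | h6
    · exact h6
    · rw [h6] at hs
      rw [← hs] at hs'
      push_cast at hs'
      -- The wrong orientation would force `1 + 1 = 0` in `ZMod 3`.
      rw [add_assoc, left_eq_add] at hs'
      exact absurd hs' (by decide)
  · intro h1
    refine ⟨(D.block ℓ (x a) : ZMod 3),
      ![.inr ⟨D.hub ℓ (x a)⟩, .inr ⟨D.hub ℓ (x (1 - a))⟩], ⟨⟨rfl, rfl⟩, rfl, .inl h1⟩,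
      D.inr_mem_mark_inr.2 ⟨rfl, rfl⟩, D.inr_mem_mark_inr.2 ⟨rfl, ?_⟩⟩
    change ((D.block ℓ (x (1 - a)) : ℕ) : ZMod 3) = _
    rw [h1]; push_cast; rfl

/-- Recovering adjacency from the properties of pairs. -/
def pairRule (Φ : L → L → (Fin h → Fin 3 → Prop) → Prop)
    (σ : (L × Fin 2) ⊕ (Fin h × ZMod 3) ⊕ (Fin h × ZMod 3 × Fin 2) → Prop) : Prop :=
  ∃ τ τ', σ (.inl (τ, 0)) ∧ σ (.inl (τ', 1)) ∧ Φ τ τ' fun ℓ =>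
    ![∃ s, σ (.inr (.inl (ℓ, s))), ∃ s, σ (.inr (.inr (ℓ, s, 0))),
      ∃ s, σ (.inr (.inr (ℓ, s, 1)))]

theorem pairRule_iff (x : Fin 2 → V) :
    pairRule Φ (fun i => pairProperty e i D.hubGraph (fun i => D.mark (e.symm i))
      (fun i => .inl (x i))) ↔
    Φ (D.label (x 0)) (D.label (x 1)) fun ℓ => blockPattern (D.block ℓ (x 0)) (D.block ℓ (x 1)) := by
  have h0 : ∀ (τ : L) (a : Fin 2), pairProperty e (.inl (τ, a)) D.hubGraph
      (fun i => D.mark (e.symm i)) (fun i => .inl (x i)) ↔ D.label (x a) = τ := by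
    intro τ a
    simp only [pairProperty, Equiv.symm_apply_apply]
    exact D.inl_mem_mark_inl
  simp only [pairRule, h0, exists_pairProperty_same, exists_pairProperty_next]
  constructor
  · rintro ⟨_, _, rfl, rfl, hΦ⟩
    exact hΦ
  · intro hΦ
    exact ⟨_, _, rfl, rfl, hΦ⟩

end LocalDescription

/-- Graphs with a local description of a given type are obtained from their graphs of blocks by a
fixed interpretation. -/
theorem exists_interpretation {h : ℕ} {L : Type} [Finite L]
    (Φ : L → L → (Fin h → Fin 3 → Prop) → Prop) :
    ∃ (p : ℕ) (I : Interpretation (Language.graph.sum (monadic (Fin p))) Language.graph),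
      ∀ {V : Type u} {G : SimpleGraph V} (D : LocalDescription G h L Φ),
        ∃ P : Fin p → Set (V ⊕ ULift.{u} D.Hub), IsInterpretedIn G I D.hubGraph P := by
  let e := Finite.equivFin (L ⊕ (Fin h × ZMod 3))
  -- The original vertices are exactly the elements carrying some label; hubs carry none.
  obtain ⟨ν, hν⟩ := IsDefinable.boolean.{u} (κ := Fin (Nat.card (L ⊕ (Fin h × ZMod 3))))
    (fun τ : L => isDefinable_mark (e (.inl τ)) (0 : Fin 1)) (fun σ => ∃ τ, σ τ)
  -- A local description says nothing about equal vertices, so loops are excluded by an explicit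
  -- inequality.
  obtain ⟨φ, hφ⟩ := (IsDefinable.boolean.{u} (isDefinable_pairProperty e)
    (fun σ => LocalDescription.pairRule Φ σ)).and
      (IsDefinable.boolean.{u} (ι := Unit) (fun _ => isDefinable_eq (0 : Fin 2) 1)
        (fun σ => ¬ σ ()))
  refine ⟨_, ⟨ν, fun {n} R => match n, R with | _, .adj => φ⟩, fun {V G} D =>
    ⟨fun i => D.mark (e.symm i), ?_⟩⟩
  let := G.structure
  let := monadicLift D.hubGraph fun i => D.mark (e.symm i)
  have hdom : ∀ x : V ⊕ ULift.{u} D.Hub, (ν.Realize fun _ => x) ↔ ∃ v, x = Sum.inl v := by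
    intro x
    rw [hν]
    simp only [Equiv.symm_apply_apply]
    constructor
    · rintro ⟨τ, hτ⟩
      rcases x with v | p
      · exact ⟨v, rfl⟩
      · exact absurd hτ D.inr_notMem_mark_inl
    · rintro ⟨v, rfl⟩
      exact ⟨_, D.inl_mem_mark_inl.2 rfl⟩
  refine ⟨⟨Equiv.ofBijective (fun v => ⟨.inl v, (hdom _).2 ⟨v, rfl⟩⟩) ⟨?_, ?_⟩, ?_, ?_⟩⟩
  · intro u v huv
    exact Sum.inl_injective (Subtype.ext_iff.1 huv)
  · rintro ⟨x, hx⟩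
    obtain ⟨v, rfl⟩ := (hdom x).1 hx
    exact ⟨v, rfl⟩
  · intro n f
    exact isEmptyElim f
  · rintro n ⟨⟩ x
    change φ.Realize (fun i => (Sum.inl (x i) : V ⊕ ULift.{u} D.Hub)) ↔ G.Adj (x 0) (x 1)
    refine (hφ _ _ _ _).trans ((and_congr_left' (D.pairRule_iff e x)).trans ?_)
    by_cases hx : x 0 = x 1
    · simp [hx]
    · rw [D.adj_iff _ _ hx]
      simp [hx]

/-- Classes of bounded linear NLC-width that exclude a semi-induced half-graph are transductions of
classes of bounded pathwidth. -/
theorem isTransductionOf_boundedPathwidth (C : GraphClass.{u}) (hC : BoundedLinearNLCWidth C)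
    (hH : ExcludesSemiInducedHalfGraph C) :
    ∃ D : GraphClass.{u}, BoundedPathwidth D ∧ IsTransductionOf C D := by
  obtain ⟨k, hk⟩ := hC
  obtain ⟨N, hN⟩ := hH
  obtain ⟨p, I, hI⟩ := exists_interpretation.{u}
    (levelAdj (K := Fin (k + 1)) (N := N) (k := k + 1))
  -- With `k + 1` colours the levels run from `0` to `k + 1`, hence `k + 2` partitions into blocks
  -- and pathwidth at most twice that number.
  refine ⟨{A | pathwidth A.graph ≤ (2 * (k + 1 + 1) : ℕ)}, ⟨_, fun A hA => hA⟩, p, I,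
    fun B hB => ?_⟩
  have := B.finite
  obtain ⟨W⟩ := exists_wordRepresentation_of_width_le (hk B hB)
  obtain ⟨D⟩ := W.exists_localDescription (k := k + 1) (by simp) (hN B hB)
  obtain ⟨P, hP⟩ := hI D
  exact ⟨⟨_, inferInstance, D.hubGraph⟩, D.pathwidth_hubGraph_le, P, hP⟩

end LinearNLC

theorem mainTheorem7 (C : LinearNLC.GraphClass.{u})
    (hC : LinearNLC.BoundedLinearNLCWidth C)
    (hH : LinearNLC.ExcludesSemiInducedHalfGraph C) :
    ∃ D : LinearNLC.GraphClass.{u},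
      LinearNLC.BoundedPathwidth D ∧ LinearNLC.IsTransductionOf C D :=
  LinearNLC.isTransductionOf_boundedPathwidth C hC hH
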